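/- Conventions. An *arrow algebra* $\mathcal A=(A,\le,\to,S)$ is a poset with all meets and a binary operation $\to$, antitone in the first and monotone in the second variable, together with an upward closed subset $S\subseteq A$, closed under modus ponens (if $a\to b\in S$ and $a\in S$ then $b\in S$), containing $\bigwedge_{a,b}a\to b\to a$, $\bigwedge_{a,b,c}(a\to b\to c)\to(a\to b)\to(a\to c)$ and $\bigwedge_{a,(b_i)_{i\in I},(c_i)_{i\in I}}\big(\bigwedge_{i\in I} a\to b_i\to c_i\big)\to a\to\big(\bigwedge_{i\in I} b_i\to c_i\big)$, the last meet being over all elements $a$ and all families in $A$ indexed by a set $I$. An *implicative morphism* $f:\mathcal A\to\mathcal B$ is a function $f:A\to B$ with $f(S_A)\subseteq S_B$, such that $\bigwedge_{a,a'}f(a\to a')\to f(a)\to f(a')\in S_B$, and such that for all $X\subseteq A\times A$, $\bigwedge_{(a,a')\in X}a\to a'\in S_A$ implies $\bigwedge_{(a,a')\in X}f(a)\to f(a')\in S_B$. Write $f\vdash f'$ if $\bigwedge_{a}f(a)\to f'(a)\in S_B$; this makes arrow algebras and implicative morphisms a preorder-enriched category $\mathrm{ArrAlg}$. An implicative morphism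 $f:\mathcal A\to\mathcal B$ is *computationally dense* if it has a right adjoint in $\mathrm{ArrAlg}$: an implicative morphism $h:\mathcal B\to\mathcal A$ with $fh\vdash\mathrm{id}_B$ and $\mathrm{id}_A\vdash hf$; $\mathrm{ArrAlg}_{\mathrm{cd}}$ is the wide subcategory of $\mathrm{ArrAlg}$ on these morphisms. A (Set-)*tripos* is a pseudofunctor $P$ from $\mathrm{Set}^{\mathrm{op}}$ to Heyting prealgebras (preorders whose poset reflection is a Heyting algebra) such that every $P(f)$ has a left adjoint and a right adjoint among monotone maps, satisfying the Beck–Chevalley condition, and such that $P$ has a generic element. A *transformation* $\Phi:P\to Q$ is a family of monotone maps $\Phi_I:P(I)\to Q(I)$, natural up to isomorphism; transformations are ordered pointwise, and $\simeq$ denotes isomorphism for this order (and likewise for $\vdash$ on implicative morphisms). A *geometric morphism* $Q\to P$ is a pair of transformations $\Phi^+:P\to Q$ (inverse image) and $\Phi_+:Q\to P$ (direct image) such that each $(\Phi^+)_I$ preserves finite meets up to isomorphism and is left adjoint to $(\Phi_+)_I$. $\mathrm{Trip}_{\mathrm{geom}}(\mathrm{Set})$ has triposes as objects and, as morphisms $P\to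 Q$, the transformations $\Phi^+:P\to Q$ that are the inverse image of a geometric morphism $Q\to P$. The *arrow tripos* $P_{\mathcal A}$ sends a set $I$ to the set $A^I$ preordered by $\phi\vdash_I\psi\iff\bigwedge_{i\in I}\phi(i)\to\psi(i)\in S$, and a function to precomposition with it. A 2-functor between preorder-enriched categories is a functor which is order-preserving on homsets; it is *2-fully faithful* if it induces equivalences of preorders on homsets. **Theorem.** 1. Let $f:\mathcal A\to\mathcal B$ be a computationally dense implicative morphism with right adjoint $h:\mathcal B\to\mathcal A$. Then $(\Phi^+)_I(\psi):=f\circ\psi$ and $(\Phi_+)_I(\phi):=h\circ\phi$ define a geometric morphism of triposes $P_{\mathcal B}\to P_{\mathcal A}$ with inverse image $\Phi^+$ and direct image $\Phi_+$. 2. The assignments $\mathcal A\mapsto P_{\mathcal A}$ and $f\mapsto (f\circ -)$ define a 2-fully faithful 2-functor $\mathrm{ArrAlg}_{\mathrm{cd}}\to\mathrm{Trip}_{\mathrm{geom}}(\mathrm{Set})$; that is, for all arrow algebras $\mathcal A,\mathcal B$ they induce an equivalence of preorders $\mathrm{ArrAlg}_{\mathrm{cd}}(\mathcal A,\mathcal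 B)\simeq\mathrm{Trip}_{\mathrm{geom}}(\mathrm{Set})(P_{\mathcal A},P_{\mathcal B})$. 3. Consequently, for every geometric morphism $(\Phi^+,\Phi_+):P_{\mathcal B}\to P_{\mathcal A}$ there are implicative morphisms $f:\mathcal A\to\mathcal B$ and $h:\mathcal B\to\mathcal A$, with $h$ right adjoint to $f$, such that $\Phi^+\simeq(f\circ-)$ and $\Phi_+\simeq(h\circ-)$; moreover every computationally dense $f':\mathcal A\to\mathcal B$ with $(f'\circ-)\simeq\Phi^+$ satisfies $f'\simeq f$. -/

import Mathlib

open CategoryTheory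

universe u v w

namespace ArrowTripos

/-! ### Preorder-enriched categories -/

/-- Isomorphic elements of a preorder. -/
abbrev PreIso {P : Type*} [Preorder P] (a b : P) : Prop := AntisymmRel (· ≤ ·) a b

infix:50 " ≃ₚ " => PreIso

/-- A preorder-enriched category: a category whose homsets are preordered in such a way that
composition is order-preserving. -/
class PreorderEnriched (C : Type w) [Category.{v} C] where
  homPreorder : ∀ X Y : C, Preorder (X ⟶ Y)
  comp_mono : ∀ {X Y Z : C} {f f' : X ⟶ Y} {g g' : Y ⟶ Z},
    f ≤ f' → g ≤ g' → f ≫ g ≤ f' ≫ g'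

attribute [instance, reducible] PreorderEnriched.homPreorder

/-- `IsAdjoint f g`: the morphism `f` is left adjoint to `g` in a preorder-enriched category. -/
def IsAdjoint {C : Type w} [Category.{v} C] [PreorderEnriched C] {X Y : C}
    (f : X ⟶ Y) (g : Y ⟶ X) : Prop :=
  𝟙 X ≤ f ≫ g ∧ g ≫ f ≤ 𝟙 Y

/-- A 2-functor between preorder-enriched categories: a functor (strictly preserving identities
and composition) which is order-preserving on homsets. -/
structure TwoFunctor (C : Type*) [Category C] [PreorderEnriched C]
    (D : Type*) [Category D] [PreorderEnriched D] extends C ⥤ D where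
  map_mono : ∀ {X Y : C} {f f' : X ⟶ Y}, f ≤ f' → toFunctor.map f ≤ toFunctor.map f'

/-- A function between preorders which is an equivalence of preorder categories: it is monotone
and has a monotone inverse up to isomorphism. -/
def IsPreorderEquivalence {P Q : Type*} [Preorder P] [Preorder Q] (F : P → Q) : Prop :=
  Monotone F ∧ ∃ G : Q → P, Monotone G ∧ (∀ x, G (F x) ≃ₚ x) ∧ ∀ y, F (G y) ≃ₚ y

/-- A 2-functor is 2-fully faithful if it induces equivalences on hom-preorders. -/
def TwoFunctor.IsTwoFullyFaithful {C : Type*} [Category C] [PreorderEnriched C]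
    {D : Type*} [Category D] [PreorderEnriched D] (F : TwoFunctor C D) : Prop :=
  ∀ X Y : C, IsPreorderEquivalence (fun f : X ⟶ Y => F.map f)

/-- A wide subcategory of a preorder-enriched category, with the induced order. -/
instance {C : Type w} [Category.{v} C] [PreorderEnriched C] (W : MorphismProperty C)
    [W.IsMultiplicative] : PreorderEnriched (WideSubcategory W) where
  homPreorder _ _ := Preorder.lift (fun f => f.hom)
  comp_mono h h' := PreorderEnriched.comp_mono (C := C) h h'

/-! ### Arrow algebras -/

/-- An arrow structure: a poset with all meets (hence a complete lattice), endowed with a binary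
operation which is antitone in the first variable and monotone in the second one. -/
class ArrowStructure (A : Type u) extends CompleteLattice A where
  arr : A → A → A
  arr_mono : ∀ {a a' b b' : A}, a' ≤ a → b ≤ b' → arr a b ≤ arr a' b'

infixr:61 " ⇾ " => ArrowStructure.arr

/-- The combinator `k`. -/
def combK (A : Type u) [ArrowStructure A] : A := ⨅ (a : A) (b : A), a ⇾ b ⇾ a

/-- The combinator `s`. -/
def combS (A : Type u) [ArrowStructure A] : A :=
  ⨅ (a : A) (b : A) (c : A), (a ⇾ b ⇾ c) ⇾ (a ⇾ b) ⇾ (a ⇾ c)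

/-- The combinator `a`; the meet is over all elements `a` and all families `(bᵢ)`, `(cᵢ)`
indexed by a (small) set `I`. -/
def combA (A : Type u) [ArrowStructure A] : A :=
  ⨅ (a : A) (I : Type u) (b : I → A) (c : I → A),
    (⨅ i, a ⇾ b i ⇾ c i) ⇾ a ⇾ ⨅ i, b i ⇾ c i

/-- A separator on an arrow structure. -/
structure IsArrowSeparator {A : Type u} [ArrowStructure A] (S : Set A) : Prop where
  upward : ∀ {a b : A}, a ∈ S → a ≤ b → b ∈ S
  modus_ponens : ∀ {a b : A}, (a ⇾ b) ∈ S → a ∈ S → b ∈ S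
  combK_mem : combK A ∈ S
  combS_mem : combS A ∈ S
  combA_mem : combA A ∈ S

/-- Arrow algebras. -/
structure ArrAlg : Type (u + 1) where
  carrier : Type u
  [str : ArrowStructure carrier]
  sep : Set carrier
  isSeparator : IsArrowSeparator sep

instance : CoeSort ArrAlg.{u} (Type u) := ⟨ArrAlg.carrier⟩

attribute [instance] ArrAlg.str

/-! Validity of families of elements of an arrow algebra, with the rules needed below. -/

section Valid

variable {A : ArrAlg.{u}}

/-- A family is valid if its meet is in the separator. -/
def Valid {I : Type w} (φ : I → A) : Prop := (⨅ i, φ i) ∈ A.sep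

theorem valid_mono {I : Type w} {φ ψ : I → A} (h : ∀ i, φ i ≤ ψ i) (hφ : Valid φ) : Valid ψ :=
  A.isSeparator.upward hφ (iInf_mono h)

theorem valid_comp {I J : Type*} {φ : I → A} (hφ : Valid φ) (g : J → I) :
    Valid fun j => φ (g j) :=
  A.isSeparator.upward hφ (le_iInf fun j => iInf_le φ (g j))

theorem valid_of_le {I : Type w} {φ : I → A} {s : A} (hs : s ∈ A.sep) (h : ∀ i, s ≤ φ i) :
    Valid φ :=
  A.isSeparator.upward hs (le_iInf h)

theorem combA_le {ι : Type u} (a : A) (b c : ι → A) :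
    combA A ≤ (⨅ i, a ⇾ b i ⇾ c i) ⇾ a ⇾ ⨅ i, b i ⇾ c i :=
  (iInf_le _ a).trans ((iInf_le _ ι).trans ((iInf_le _ b).trans (iInf_le _ c)))

/-- The `a` combinator, for families indexed by an arbitrary type. -/
theorem combA_le' {ι : Type w} (a : A) (b c : ι → A) :
    combA A ≤ (⨅ i, a ⇾ b i ⇾ c i) ⇾ a ⇾ ⨅ i, b i ⇾ c i := by
  let R : Type u := {p : A × A // ∃ i, (b i, c i) = p}
  have h1 : (⨅ i, b i ⇾ c i) = ⨅ r : R, r.1.1 ⇾ r.1.2 := by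
    apply le_antisymm
    · refine le_iInf fun r => ?_
      obtain ⟨_, i, rfl⟩ := r
      exact iInf_le _ i
    · exact le_iInf fun i => iInf_le (fun r : R => r.1.1 ⇾ r.1.2) ⟨(b i, c i), i, rfl⟩
  have h2 : (⨅ i, a ⇾ b i ⇾ c i) = ⨅ r : R, a ⇾ r.1.1 ⇾ r.1.2 := by
    apply le_antisymm
    · refine le_iInf fun r => ?_
      obtain ⟨_, i, rfl⟩ := r
      exact iInf_le _ i
    · exact le_iInf fun i => iInf_le (fun r : R => a ⇾ r.1.1 ⇾ r.1.2) ⟨(b i, c i), i, rfl⟩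
  rw [h1, h2]
  exact combA_le a _ _

theorem valid_mp {I : Type w} {x y z : I → A} (h : Valid fun i => x i ⇾ y i ⇾ z i)
    (hx : Valid x) : Valid fun i => y i ⇾ z i := by
  have h1 : (⨅ i, (⨅ i, x i) ⇾ y i ⇾ z i) ∈ A.sep :=
    valid_mono (fun i => ArrowStructure.arr_mono (iInf_le x i) le_rfl) h
  have h2 := A.isSeparator.upward A.isSeparator.combA_mem (combA_le' (⨅ i, x i) y z)
  exact A.isSeparator.modus_ponens (A.isSeparator.modus_ponens h2 h1) hx

theorem valid_K {I : Type w} (x y : I → A) : Valid fun i => x i ⇾ y i ⇾ x i :=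
  valid_of_le A.isSeparator.combK_mem fun i => (iInf_le _ (x i)).trans (iInf_le _ (y i))

theorem valid_S {I : Type w} (x y z : I → A) :
    Valid fun i => (x i ⇾ y i ⇾ z i) ⇾ (x i ⇾ y i) ⇾ (x i ⇾ z i) :=
  valid_of_le A.isSeparator.combS_mem fun i =>
    (iInf_le _ (x i)).trans ((iInf_le _ (y i)).trans (iInf_le _ (z i)))

theorem valid_mp1 {I : Type w} {x y z : I → A} (h : Valid fun i => x i ⇾ y i ⇾ z i)
    (h' : Valid fun i => x i ⇾ y i) : Valid fun i => x i ⇾ z i :=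
  valid_mp (valid_mp (valid_S x y z) h) h'

theorem valid_lift {I : Type w} {x : I → A} (h : Valid x) (y : I → A) :
    Valid fun i => y i ⇾ x i :=
  valid_mp (valid_K x y) h

theorem valid_refl {I : Type w} (x : I → A) : Valid fun i => x i ⇾ x i :=
  valid_mp1 (valid_K x fun i => x i ⇾ x i) (valid_K x x)

theorem valid_trans {I : Type w} {x y z : I → A} (h : Valid fun i => x i ⇾ y i)
    (h' : Valid fun i => y i ⇾ z i) : Valid fun i => x i ⇾ z i :=
  valid_mp1 (valid_lift h' x) h

theorem valid_mp2 {I : Type w} {x y z t : I → A}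
    (h : Valid fun i => x i ⇾ y i ⇾ z i ⇾ t i)
    (h' : Valid fun i => x i ⇾ y i ⇾ z i) : Valid fun i => x i ⇾ y i ⇾ t i :=
  valid_mp1 (valid_mp1 (valid_lift (valid_S y z t) x) h) h'

theorem valid_swap {I : Type w} {x y z : I → A} (h : Valid fun i => x i ⇾ y i ⇾ z i) :
    Valid fun i => y i ⇾ x i ⇾ z i :=
  valid_mp2 (valid_mp2 (valid_lift (valid_lift h x) y) (valid_lift (valid_refl x) y))
    (valid_K y x)

theorem valid_of_pointwise_le {I : Type w} {x y : I → A} (h : ∀ i, x i ≤ y i) :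
    Valid fun i => x i ⇾ y i :=
  valid_mono (fun i => ArrowStructure.arr_mono le_rfl (h i)) (valid_refl x)

/-- Moving a meet of implications to the right of an implication. -/
theorem valid_iInf {I : Type*} {J : I → Type*} {x : I → A} {y z : ∀ i, J i → A}
    (h : Valid fun p : Σ i, J i => x p.1 ⇾ y p.1 p.2 ⇾ z p.1 p.2) :
    Valid fun i => x i ⇾ ⨅ j, y i j ⇾ z i j := by
  have h1 : Valid fun i => ⨅ j : J i, x i ⇾ y i j ⇾ z i j :=
    valid_of_le h fun i => le_iInf fun j => iInf_le _ (⟨i, j⟩ : Σ i, J i)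
  exact valid_mp (valid_of_le A.isSeparator.combA_mem fun i => combA_le' _ _ _) h1

theorem top_mem (A : ArrAlg.{u}) : (⊤ : A) ∈ A.sep :=
  A.isSeparator.upward A.isSeparator.combK_mem le_top

end Valid

/-! ### The preorder-enriched category of arrow algebras -/

/-- Implicative morphisms. -/
@[ext]
structure ImplicativeMorphism (A B : ArrAlg.{u}) where
  toFun : A → B
  map_sep : ∀ a ∈ A.sep, toFun a ∈ B.sep
  realized : ∃ r ∈ B.sep, ∀ a a' : A, r ≤ toFun (a ⇾ a') ⇾ toFun a ⇾ toFun a'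
  map_iInf : ∀ X : Set (A × A), (⨅ p ∈ X, p.1 ⇾ p.2) ∈ A.sep →
    (⨅ p ∈ X, toFun p.1 ⇾ toFun p.2) ∈ B.sep

theorem ImplicativeMorphism.map_valid {A B : ArrAlg.{u}} (f : ImplicativeMorphism A B)
    {I : Type w} {x y : I → A} (h : Valid fun i => x i ⇾ y i) :
    Valid fun i => f.toFun (x i) ⇾ f.toFun (y i) := by
  have h1 : (⨅ p ∈ Set.range fun i => (x i, y i), p.1 ⇾ p.2) ∈ A.sep := by
    rw [iInf_range]; exact h
  have h2 := f.map_iInf _ h1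
  rw [iInf_range] at h2
  exact h2

theorem ImplicativeMorphism.valid_realized {A B : ArrAlg.{u}} (f : ImplicativeMorphism A B)
    {I : Type w} (x y : I → A) :
    Valid fun i => f.toFun (x i ⇾ y i) ⇾ f.toFun (x i) ⇾ f.toFun (y i) := by
  obtain ⟨r, hr, h⟩ := f.realized
  exact valid_of_le hr fun i => h _ _

/-- The category of arrow algebras and implicative morphisms. -/
instance : Category ArrAlg.{u} where
  Hom A B := ImplicativeMorphism A B
  id A :=
    { toFun := fun a => a
      map_sep := fun _ h => h
      realized := ⟨_, valid_refl fun p : A × A => p.1 ⇾ p.2, fun a a' => iInf_le _ (a, a')⟩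
      map_iInf := fun _ h => h }
  comp {A B C} f g :=
    { toFun := fun a => g.toFun (f.toFun a)
      map_sep := fun a h => g.map_sep _ (f.map_sep a h)
      realized := ⟨_, valid_trans
        (g.map_valid (f.valid_realized (fun p : A × A => p.1) fun p => p.2))
        (g.valid_realized (fun p : A × A => f.toFun p.1) fun p => f.toFun p.2),
        fun a a' => iInf_le _ (a, a')⟩
      map_iInf := fun X h => by
        rw [iInf_subtype'] at h ⊢
        exact g.map_valid (f.map_valid (I := X) (x := fun p => p.1.1) (y := fun p => p.1.2) h) }

/-- The order on implicative morphisms: `f ≤ f'` if some `r ∈ S_B` satisfies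
`r ≤ f a ⇾ f' a` for all `a`. -/
instance : PreorderEnriched ArrAlg.{u} where
  homPreorder A B :=
    { le := fun f f' => ∃ r ∈ B.sep, ∀ a : A, r ≤ f.toFun a ⇾ f'.toFun a
      le_refl := fun f => ⟨_, valid_refl f.toFun, fun a => iInf_le _ a⟩
      le_trans := fun _ _ _ ⟨_, hr, h⟩ ⟨_, hr', h'⟩ =>
        ⟨_, valid_trans (valid_of_le hr h) (valid_of_le hr' h'), fun a => iInf_le _ a⟩ }
  comp_mono {A B C f f' g g'} := fun ⟨_, hr, h⟩ ⟨_, hr', h'⟩ =>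
    ⟨_, valid_trans (ImplicativeMorphism.map_valid g (valid_of_le hr h))
      (valid_of_le (φ := fun a => g.toFun (f'.toFun a) ⇾ g'.toFun (f'.toFun a)) hr'
        fun a => h' (f'.toFun a)),
      fun a => iInf_le _ a⟩

/-- Computationally dense implicative morphisms, as a class of morphisms of `ArrAlg`. -/
def computationallyDense : MorphismProperty ArrAlg.{u} :=
  fun _ _ f => ∃ h, IsAdjoint f h

instance : computationallyDense.{u}.IsMultiplicative where
  id_mem A := ⟨𝟙 A, by simp [IsAdjoint]⟩
  comp_mem := by
    rintro A B C f g ⟨h, h1, h2⟩ ⟨k, k1, k2⟩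
    refine ⟨k ≫ h, ?_, ?_⟩
    · have := PreorderEnriched.comp_mono (PreorderEnriched.comp_mono (le_refl f) k1) (le_refl h)
      simp only [Category.comp_id, Category.assoc] at this
      simpa only [Category.assoc] using h1.trans this
    · have := PreorderEnriched.comp_mono (PreorderEnriched.comp_mono (le_refl k) h2) (le_refl g)
      simp only [Category.comp_id, Category.assoc] at this
      simpa only [Category.assoc] using this.trans k2

/-- The wide subcategory of `ArrAlg` on computationally dense morphisms. -/
abbrev ArrAlgCd : Type (u + 1) := WideSubcategory computationallyDense.{u}

/-! ### Heyting prealgebras -/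

section Heyting

/-- `e` is a Heyting implication of `a` and `b` in a preorder with binary meets. -/
def IsHeytingImp {P : Type*} [Preorder P] (a b e : P) : Prop :=
  ∀ c m : P, IsGLB {c, a} m → (c ≤ e ↔ m ≤ b)

/-- A Heyting prealgebra: a preorder whose poset reflection is a Heyting algebra. -/
structure IsHeytingPrealgebra (P : Type*) [Preorder P] : Prop where
  top : ∃ t : P, IsTop t
  bot : ∃ t : P, IsBot t
  inf : ∀ a b : P, ∃ m, IsGLB {a, b} m
  sup : ∀ a b : P, ∃ m, IsLUB {a, b} m
  imp : ∀ a b : P, ∃ e, IsHeytingImp a b e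

/-- Preservation of finite meets, up to isomorphism. -/
structure PreservesFiniteMeets {P Q : Type*} [Preorder P] [Preorder Q] (f : P → Q) : Prop where
  top : ∀ t, IsTop t → IsTop (f t)
  inf : ∀ a b m, IsGLB {a, b} m → IsGLB {f a, f b} (f m)

/-- Morphisms of Heyting prealgebras. -/
structure IsHeytingHom {P Q : Type*} [Preorder P] [Preorder Q] (f : P → Q) : Prop
    extends PreservesFiniteMeets f where
  mono : Monotone f
  bot : ∀ t, IsBot t → IsBot (f t)
  sup : ∀ a b m, IsLUB {a, b} m → IsLUB {f a, f b} (f m)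
  imp : ∀ a b e, IsHeytingImp a b e → IsHeytingImp (f a) (f b) (f e)

end Heyting

/-! ### Triposes -/

/-- Pullback squares of sets, with `h ∘ f = k ∘ g`. -/
def IsPullbackSquare {X Y Z W : Type u} (f : X → Y) (g : X → Z) (h : Y → W) (k : Z → W) : Prop :=
  (∀ x, h (f x) = k (g x)) ∧ ∀ y z, h y = k z → ∃! x, f x = y ∧ g x = z

/-- A (Set-)tripos: a pseudofunctor from `Set` (contravariantly) to Heyting prealgebras, such that
reindexings have left and right adjoints satisfying the Beck-Chevalley condition, and
having a generic element. -/
structure Tripos : Type (u + 2) where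
  obj : Type u → Type u
  [preorder : ∀ X, Preorder (obj X)]
  heyting : ∀ X, IsHeytingPrealgebra (obj X)
  /-- Reindexing `f^*` along `f`. -/
  map : ∀ {X Y : Type u}, (X → Y) → obj Y → obj X
  map_heyting : ∀ {X Y : Type u} (f : X → Y), IsHeytingHom (map f)
  map_id : ∀ {X : Type u} (φ : obj X), map (fun x : X => x) φ ≃ₚ φ
  map_comp : ∀ {X Y Z : Type u} (f : X → Y) (g : Y → Z) (φ : obj Z),
    map (fun x => g (f x)) φ ≃ₚ map f (map g φ)
  exists_leftAdjoint : ∀ {X Y : Type u} (f : X → Y),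
    ∃ ex : obj X → obj Y, GaloisConnection ex (map f)
  exists_rightAdjoint : ∀ {X Y : Type u} (f : X → Y),
    ∃ al : obj X → obj Y, GaloisConnection (map f) al
  beckChevalley : ∀ {X Y Z W : Type u} (f : X → Y) (g : X → Z) (h : Y → W) (k : Z → W),
    IsPullbackSquare f g h k →
    ∀ (al_g : obj X → obj Z) (al_h : obj Y → obj W),
      GaloisConnection (map g) al_g → GaloisConnection (map h) al_h →
      ∀ φ : obj Y, map k (al_h φ) ≃ₚ al_g (map f φ)
  exists_generic : ∃ (T : Type u) (σ : obj T), ∀ (X : Type u) (φ : obj X),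
    ∃ χ : X → T, φ ≃ₚ map χ σ

attribute [instance] Tripos.preorder

/-- Transformations of triposes: families of order-preserving functions, natural up to
isomorphism. -/
@[ext]
structure Transformation (P Q : Tripos.{u}) where
  app : ∀ X : Type u, P.obj X → Q.obj X
  mono : ∀ X, Monotone (app X)
  natural : ∀ {X Y : Type u} (f : X → Y) (φ : P.obj Y),
    app X (P.map f φ) ≃ₚ Q.map f (app Y φ)

/-- The category of triposes and transformations. -/
instance : Category Tripos.{u} where
  Hom P Q := Transformation P Q
  id P :=
    { app := fun _ φ => φ
      mono := fun _ => monotone_id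
      natural := fun _ _ => AntisymmRel.rfl }
  comp {P Q R} Φ Ψ :=
    { app := fun X φ => Ψ.app X (Φ.app X φ)
      mono := fun X => (Ψ.mono X).comp (Φ.mono X)
      natural := fun {X Y} f φ =>
        AntisymmRel.trans
          (b := Ψ.app X (Q.map f (Φ.app Y φ)))
          ⟨Ψ.mono X (Φ.natural f φ).1, Ψ.mono X (Φ.natural f φ).2⟩
          (Ψ.natural f (Φ.app Y φ)) }

/-- Transformations are ordered pointwise. -/
instance : PreorderEnriched Tripos.{u} where
  homPreorder P Q :=
    { le := fun Φ Ψ => ∀ (X : Type u) (φ : P.obj X), Φ.app X φ ≤ Ψ.app X φ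
      le_refl := fun _ _ _ => le_refl _
      le_trans := fun _ _ _ h h' X φ => (h X φ).trans (h' X φ) }
  comp_mono {P Q R Φ Φ' Ψ Ψ'} h h' := fun X φ =>
    (Ψ.mono X (h X φ)).trans (h' X (Φ'.app X φ))

/-- Cartesian transformations. -/
def IsCartesian {P Q : Tripos.{u}} (Φ : P ⟶ Q) : Prop :=
  ∀ X : Type u, PreservesFiniteMeets (Φ.app X)

/-- `IsGeometricMorphism Φinv Φdir`: the pair `(Φinv, Φdir)`, consisting of the inverse image
`Φinv : P ⟶ Q` and of the direct image `Φdir : Q ⟶ P`, is a geometric morphism from `Q` to `P`,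
that is, `Φinv` is cartesian and `Φdir` is right adjoint to it at each component. -/
def IsGeometricMorphism {P Q : Tripos.{u}} (Φinv : P ⟶ Q) (Φdir : Q ⟶ P) : Prop :=
  IsCartesian Φinv ∧ ∀ X : Type u, GaloisConnection (Φinv.app X) (Φdir.app X)

/-- Cartesian transformations having a right adjoint. -/
def geometric : MorphismProperty Tripos.{u} :=
  fun _ _ Φ => ∃ Ψ, IsGeometricMorphism Φ Ψ

instance : geometric.{u}.IsMultiplicative where
  id_mem P := ⟨𝟙 P, fun _ => ⟨fun _ h => h, fun _ _ _ h => h⟩, fun _ => GaloisConnection.id⟩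
  comp_mem := by
    rintro P Q R Φ Ψ ⟨Φ', h, h'⟩ ⟨Ψ', k, k'⟩
    exact ⟨Ψ' ≫ Φ', fun X => ⟨fun t ht => (k X).top _ ((h X).top t ht),
      fun a b m hm => (k X).inf _ _ _ ((h X).inf a b m hm)⟩, fun X => (h' X).compose (k' X)⟩

/-- The category of triposes and geometric morphisms, in the direction of the inverse image:
a morphism `P ⟶ Q` is a cartesian transformation `P ⟶ Q` having a right adjoint. -/
abbrev TripGeom : Type (u + 2) := WideSubcategory geometric.{u}

/-! ### Arrow triposes -/

/-- The predicates on a set `I` in the arrow tripos of `A`. -/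
def ArrowPred (A : ArrAlg.{u}) (I : Type u) : Type u := I → A

/-- The logical order on predicates: `φ ≤ ψ` if and only if `⨅ i, φ i ⇾ ψ i` is in
the separator. -/
instance (A : ArrAlg.{u}) (I : Type u) : Preorder (ArrowPred A I) where
  le φ ψ := (⨅ i, φ i ⇾ ψ i) ∈ A.sep
  le_refl φ := valid_refl φ
  le_trans _ _ _ h h' := valid_trans h h'

namespace ArrowPred

variable {A : ArrAlg.{u}} {I J : Type u}

/-- Reindexing of predicates. -/
def reindex (A : ArrAlg.{u}) {I J : Type u} (f : J → I) (φ : ArrowPred A I) : ArrowPred A J :=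
  fun j => φ (f j)

/-- Universal quantification of predicates. -/
def all (f : J → I) (α : ArrowPred A J) : ArrowPred A I :=
  fun i => ⨅ j : {j : J // f j = i}, ⊤ ⇾ α j

/-- Existential quantification of predicates. -/
def ex (f : J → I) (α : ArrowPred A J) : ArrowPred A I :=
  fun i => ⨅ a : A, (⨅ j : {j : J // f j = i}, α j ⇾ a) ⇾ a

theorem reindex_mono (f : J → I) : Monotone (reindex A f) :=
  fun _ _ h => valid_comp h f

theorem valid_top (I : Type w) : Valid fun _ : I => (⊤ : A) :=
  valid_of_le (top_mem A) fun _ => le_rfl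

theorem gc_all (f : J → I) : GaloisConnection (reindex A f) (all f) := by
  intro φ α
  constructor
  · intro h
    refine valid_iInf (J := fun i => {j : J // f j = i}) (x := φ) (y := fun _ _ => ⊤)
      (z := fun _ j => α j) ?_
    have h1 : Valid fun p : Σ i, {j : J // f j = i} => φ p.1 ⇾ α p.2 := by
      refine valid_mono (fun p => ?_) (valid_comp h fun p : Σ i, {j : J // f j = i} => p.2.1)
      obtain ⟨i, j, rfl⟩ := p
      exact le_rfl
    exact valid_trans h1 (valid_K _ _)
  · intro h
    have h1 : Valid fun j => φ (f j) ⇾ ⊤ ⇾ α j :=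
      valid_mono (fun j => ArrowStructure.arr_mono le_rfl
        (iInf_le (fun j' : {j' : J // f j' = f j} => ⊤ ⇾ α j') ⟨j, rfl⟩)) (valid_comp h f)
    exact valid_mp (valid_swap h1) (valid_top J)

theorem gc_ex (f : J → I) : GaloisConnection (ex f) (reindex A f) := by
  intro α β
  constructor
  · intro h
    refine valid_trans (y := fun j => ex f α (f j)) ?_ (valid_comp h f)
    refine valid_iInf (J := fun _ => A) (x := α)
      (y := fun j a => ⨅ j' : {j' : J // f j' = f j}, α j' ⇾ a) (z := fun _ a => a) ?_
    have h1 : Valid fun p : Σ _ : J, A =>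
        (⨅ j' : {j' : J // f j' = f p.1}, α j' ⇾ p.2) ⇾ α p.1 ⇾ p.2 :=
      valid_of_pointwise_le fun p =>
        iInf_le (fun j' : {j' : J // f j' = f p.1} => α j' ⇾ p.2) ⟨p.1, rfl⟩
    exact valid_swap h1
  · intro h
    have h1 : Valid fun i => ex f α i ⇾ (⨅ j : {j : J // f j = i}, α j ⇾ β i) ⇾ β i :=
      valid_of_pointwise_le fun i => iInf_le _ (β i)
    refine valid_mp (valid_swap h1) (valid_of_le h fun i => le_iInf ?_)
    rintro ⟨j, rfl⟩
    exact iInf_le (fun j => α j ⇾ β (f j)) j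

/-- Binary meets of predicates. -/
def inf (φ ψ : ArrowPred A I) : ArrowPred A I :=
  fun i => ⨅ c : A, (φ i ⇾ ψ i ⇾ c) ⇾ c

/-- Implication of predicates. -/
def imp (φ ψ : ArrowPred A I) : ArrowPred A I := fun i => φ i ⇾ ψ i

theorem valid_pair (φ ψ : ArrowPred A I) : Valid fun i => φ i ⇾ ψ i ⇾ inf φ ψ i := by
  have h1 : Valid fun p : Σ _ : I, A =>
      φ p.1 ⇾ ψ p.1 ⇾ (φ p.1 ⇾ ψ p.1 ⇾ p.2) ⇾ p.2 := by
    have e : Valid fun p : Σ _ : I, A =>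
        φ p.1 ⇾ (φ p.1 ⇾ ψ p.1 ⇾ p.2) ⇾ ψ p.1 ⇾ p.2 :=
      valid_swap (valid_refl fun p : Σ _ : I, A => φ p.1 ⇾ ψ p.1 ⇾ p.2)
    have sw : Valid fun p : Σ _ : I, A =>
        ((φ p.1 ⇾ ψ p.1 ⇾ p.2) ⇾ ψ p.1 ⇾ p.2) ⇾ ψ p.1 ⇾ (φ p.1 ⇾ ψ p.1 ⇾ p.2) ⇾ p.2 := by
      have s1 := valid_S (fun p : Σ _ : I, A => φ p.1 ⇾ ψ p.1 ⇾ p.2) (fun p => ψ p.1)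
        (fun p => p.2)
      have s2 : Valid fun p : Σ _ : I, A => ψ p.1 ⇾ (φ p.1 ⇾ ψ p.1 ⇾ p.2) ⇾ ψ p.1 :=
        valid_K _ _
      exact valid_mp2 (valid_trans s1 (valid_K _ _)) (valid_lift s2 _)
    exact valid_trans e sw
  have h3 : Valid fun i => φ i ⇾ ⨅ c : A, ψ i ⇾ (φ i ⇾ ψ i ⇾ c) ⇾ c :=
    valid_iInf (J := fun _ => A) (x := φ) (y := fun i _ => ψ i)
      (z := fun i c => (φ i ⇾ ψ i ⇾ c) ⇾ c) h1
  exact valid_trans h3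
    (valid_of_le A.isSeparator.combA_mem fun i => combA_le' _ _ _)

theorem inf_le_left (φ ψ : ArrowPred A I) : inf φ ψ ≤ φ := by
  have h1 : Valid fun i => inf φ ψ i ⇾ (φ i ⇾ ψ i ⇾ φ i) ⇾ φ i :=
    valid_of_pointwise_le fun i => iInf_le _ (φ i)
  exact valid_mp (valid_swap h1) (valid_K _ _)

theorem inf_le_right (φ ψ : ArrowPred A I) : inf φ ψ ≤ ψ := by
  have h1 : Valid fun i => inf φ ψ i ⇾ (φ i ⇾ ψ i ⇾ ψ i) ⇾ ψ i :=
    valid_of_pointwise_le fun i => iInf_le _ (ψ i)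
  exact valid_mp (valid_swap h1) (valid_lift (valid_refl _) _)

theorem isGLB_inf (φ ψ : ArrowPred A I) : IsGLB {φ, ψ} (inf φ ψ) := by
  refine ⟨?_, fun χ hχ => ?_⟩
  · rintro _ (rfl | rfl)
    exacts [inf_le_left _ _, inf_le_right _ _]
  · have h1 : χ ≤ φ := hχ (by simp)
    have h2 : χ ≤ ψ := hχ (by simp)
    exact valid_mp1 (valid_trans h1 (valid_pair φ ψ)) h2

/-- Binary joins of predicates. -/
def sup (φ ψ : ArrowPred A I) : ArrowPred A I :=
  fun i => ⨅ c : A, (φ i ⇾ c) ⇾ (ψ i ⇾ c) ⇾ c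

theorem isLUB_sup (φ ψ : ArrowPred A I) : IsLUB {φ, ψ} (sup φ ψ) := by
  refine ⟨?_, fun χ hχ => ?_⟩
  · rintro _ (rfl | rfl)
    · rename_i χ
      have h1 : Valid fun p : Σ _ : I, A =>
          χ p.1 ⇾ (χ p.1 ⇾ p.2) ⇾ (ψ p.1 ⇾ p.2) ⇾ p.2 :=
        valid_trans (valid_swap (valid_refl fun p : Σ _ : I, A => χ p.1 ⇾ p.2))
          (valid_mp (valid_S _ _ _) (valid_lift (valid_K _ _) _))
      exact valid_iInf (J := fun _ => A) (x := χ) (y := fun i c => χ i ⇾ c)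
        (z := fun i c => (ψ i ⇾ c) ⇾ c) h1
    · rename_i χ
      have h1 : Valid fun p : Σ _ : I, A =>
          χ p.1 ⇾ (φ p.1 ⇾ p.2) ⇾ (χ p.1 ⇾ p.2) ⇾ p.2 :=
        valid_trans (valid_swap (valid_refl fun p : Σ _ : I, A => χ p.1 ⇾ p.2)) (valid_K _ _)
      exact valid_iInf (J := fun _ => A) (x := χ) (y := fun i c => φ i ⇾ c)
        (z := fun i c => (χ i ⇾ c) ⇾ c) h1
  · have h1 : φ ≤ χ := hχ (by simp)
    have h2 : ψ ≤ χ := hχ (by simp)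
    have h3 : Valid fun i => sup φ ψ i ⇾ (φ i ⇾ χ i) ⇾ (ψ i ⇾ χ i) ⇾ χ i :=
      valid_of_pointwise_le fun i => iInf_le _ (χ i)
    exact valid_mp (valid_swap (valid_mp (valid_swap h3) h1)) h2

theorem imp_gc (χ φ ψ : ArrowPred A I) : χ ≤ imp φ ψ ↔ inf χ φ ≤ ψ := by
  constructor
  · intro h
    exact valid_mp1 (valid_trans (inf_le_left χ φ) h) (inf_le_right χ φ)
  · intro h
    exact valid_mp2 (valid_lift (valid_lift h φ) χ) (valid_pair χ φ)

theorem isHeytingImp_imp (φ ψ : ArrowPred A I) : IsHeytingImp φ ψ (imp φ ψ) := by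
  intro χ m hm
  rw [imp_gc]
  exact ⟨((isGLB_inf χ φ).2 hm.1).trans, (hm.2 (isGLB_inf χ φ).1).trans⟩

theorem le_of_isHeytingImp {P : Type*} [Preorder P] (hP : IsHeytingPrealgebra P)
    {a b e e' : P} (h : IsHeytingImp a b e) (h' : IsHeytingImp a b e') : e ≤ e' := by
  obtain ⟨m, hm⟩ := hP.inf e a
  exact (h' e m hm).2 ((h e m hm).1 le_rfl)

theorem isHeytingImp_congr {P : Type*} [Preorder P] {a b e e' : P} (h : IsHeytingImp a b e)
    (he : e ≃ₚ e') : IsHeytingImp a b e' := fun c m hm =>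
  ⟨fun hc => (h c m hm).1 (hc.trans he.2), fun hc => ((h c m hm).2 hc).trans he.1⟩

theorem isHeytingPrealgebra (A : ArrAlg.{u}) (I : Type u) :
    IsHeytingPrealgebra (ArrowPred A I) where
  top := ⟨fun _ => ⊤, fun φ => valid_of_pointwise_le (x := φ) fun _ => le_top⟩
  bot := ⟨fun _ => ⊥, fun φ => valid_of_pointwise_le (y := φ) fun _ => bot_le⟩
  inf φ ψ := ⟨_, isGLB_inf φ ψ⟩
  sup φ ψ := ⟨_, isLUB_sup φ ψ⟩
  imp φ ψ := ⟨_, isHeytingImp_imp φ ψ⟩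

theorem isHeytingHom_reindex (A : ArrAlg.{u}) (f : J → I) : IsHeytingHom (reindex A f) where
  top t ht φ := ((gc_ex f) φ t).1 (ht _)
  inf a b m hm := by
    have := (gc_ex (A := A) f).isGLB_u_image hm
    rwa [Set.image_pair] at this
  mono := reindex_mono f
  bot t ht φ := ((gc_all f) t φ).2 (ht _)
  sup a b m hm := by
    have := (gc_all (A := A) f).isLUB_l_image hm
    rwa [Set.image_pair] at this
  imp a b e he :=
    isHeytingImp_congr (isHeytingImp_imp (reindex A f a) (reindex A f b))
      (e := reindex A f (imp a b))
      ⟨reindex_mono f (le_of_isHeytingImp (isHeytingPrealgebra A I) (isHeytingImp_imp a b) he),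
        reindex_mono f (le_of_isHeytingImp (isHeytingPrealgebra A I) he (isHeytingImp_imp a b))⟩

theorem beckChevalley_all {X Y Z W : Type u} {f : X → Y} {g : X → Z} {h : Y → W} {k : Z → W}
    (sq : IsPullbackSquare f g h k) (φ : ArrowPred A Y) :
    reindex A k (all h φ) = all g (reindex A f φ) := by
  funext z
  apply le_antisymm
  · refine le_iInf ?_
    rintro ⟨x, rfl⟩
    exact iInf_le (fun y : {y : Y // h y = k (g x)} => ⊤ ⇾ φ y) ⟨f x, sq.1 x⟩
  · refine le_iInf ?_
    rintro ⟨y, hy⟩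
    obtain ⟨x, ⟨rfl, hx⟩, -⟩ := sq.2 y z hy
    exact iInf_le (fun x : {x : X // g x = z} => ⊤ ⇾ φ (f x)) ⟨x, hx⟩

end ArrowPred

theorem preIso_of_gc {P Q : Type*} [Preorder P] [Preorder Q] {l : P → Q} {r r' : Q → P}
    (h : GaloisConnection l r) (h' : GaloisConnection l r') (x : Q) : r x ≃ₚ r' x :=
  ⟨(h' _ _).1 ((h _ _).2 le_rfl), (h _ _).1 ((h' _ _).2 le_rfl)⟩

/-- The arrow tripos of an arrow algebra `A`: it sends a set `I` to the set of functions `I → A`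
with the logical order, and a function `f` to the precomposition with `f`. -/
def arrowTripos (A : ArrAlg.{u}) : Tripos.{u} where
  obj I := ArrowPred A I
  heyting I := ArrowPred.isHeytingPrealgebra A I
  map f := ArrowPred.reindex A f
  map_heyting f := ArrowPred.isHeytingHom_reindex A f
  map_id _ := AntisymmRel.rfl
  map_comp _ _ _ := AntisymmRel.rfl
  exists_leftAdjoint f := ⟨_, ArrowPred.gc_ex f⟩
  exists_rightAdjoint f := ⟨_, ArrowPred.gc_all f⟩
  beckChevalley {X Y Z W} f g h k sq al_g al_h hg hh φ := by
    have h1 := preIso_of_gc hh (ArrowPred.gc_all h) φ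
    have h2 := preIso_of_gc (ArrowPred.gc_all g) hg (ArrowPred.reindex A f φ)
    have h3 := ArrowPred.beckChevalley_all sq φ
    exact AntisymmRel.trans
      (b := ArrowPred.reindex A k (ArrowPred.all h φ))
      ⟨ArrowPred.reindex_mono k h1.1, ArrowPred.reindex_mono k h1.2⟩ (h3 ▸ h2)
  exists_generic := ⟨A, fun a => a, fun _ φ => ⟨φ, AntisymmRel.rfl⟩⟩

/-- The transformation of arrow triposes `φ ↦ f ∘ φ` induced by an implicative morphism `f`. -/
def postcomp {A B : ArrAlg.{u}} (f : A ⟶ B) : arrowTripos A ⟶ arrowTripos B where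
  app I := fun (φ : I → A) (i : I) => ImplicativeMorphism.toFun f (φ i)
  mono _ _ _ h := ImplicativeMorphism.map_valid f h
  natural _ _ := AntisymmRel.rfl

/-- The functor sending an arrow algebra to its arrow tripos and an implicative morphism `f` to
the transformation `φ ↦ f ∘ φ`. -/
def arrowTriposFunctor : ArrAlg.{u} ⥤ Tripos.{u} where
  obj := arrowTripos
  map f := postcomp f

end ArrowTripos

open ArrowTripos

namespace ArrowTripos

/-! The identity function, seen as a predicate on the set `A`, is generic in `arrowTripos A`: every
predicate `φ` is its reindexing along `φ`. As in the Yoneda lemma, naturality then makes a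
transformation `Φ` isomorphic to post-composition with `Transformation.generic Φ`, its value at that
predicate.

When `Φ` is cartesian this function is an implicative morphism (`implicativeOfCartesian`):
preservation of top gives `map_sep`, preservation of binary meets gives `realized` by currying, and
monotonicity over index sets `X ⊆ A × A` gives `map_iInf`. Conversely, implicative morphisms induce
cartesian transformations (`isCartesian_postcomp`).

Evaluation at the generic predicate also shows that post-composition preserves and reflects the
order (`postcomp_le_postcomp_iff`). Being strictly functorial, it then preserves and reflects
adjunctions (`isAdjoint_postcomp_iff`). In a geometric morphism the direct image, as a right
adjoint, is cartesian too. Both halves thus come from implicative morphisms, and their adjunction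
descends to arrow algebras. -/

/-- Since `F` reflects the order, any choice of preimages up to isomorphism is automatically
monotone and inverse to `F`. -/
theorem isPreorderEquivalence_of_le_iff {P Q : Type*} [Preorder P] [Preorder Q] {F : P → Q}
    (hle : ∀ x y, F x ≤ F y ↔ x ≤ y) (hsurj : ∀ y, ∃ x, F x ≃ₚ y) :
    IsPreorderEquivalence F := by
  choose G hG using hsurj
  refine ⟨fun x y h => (hle x y).2 h, G, fun y y' h => ?_, fun x => ?_, hG⟩
  · exact (hle _ _).1 ((hG y).1.trans (h.trans (hG y').2))
  · exact ⟨(hle _ _).1 (hG (F x)).1, (hle _ _).1 (hG (F x)).2⟩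

/-- Applied to direct images, this makes them cartesian, so that they too come from implicative
morphisms. -/
theorem preservesFiniteMeets_of_gc {P Q : Type*} [Preorder P] [Preorder Q]
    {l : P → Q} {r : Q → P} (h : GaloisConnection l r) : PreservesFiniteMeets r where
  top _ ht a := (h a _).1 (ht _)
  inf a b m hm := by
    have := h.isGLB_u_image hm
    rwa [Set.image_pair] at this

/-! ### Top predicates and the separator -/

variable {A B : ArrAlg.{u}}

/-- Constant predicates. -/
def ArrowPred.const (I : Type u) (a : A) : ArrowPred A I := fun _ => a

/-- Post-composition of predicates with a function. -/
def ArrowPred.postcomp {I : Type u} (g : A → B) (φ : ArrowPred A I) : ArrowPred B I :=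
  fun i => g (φ i)

theorem isTop_of_mem_sep {I : Type u} {a : A} (h : a ∈ A.sep) :
    IsTop (ArrowPred.const I a) :=
  fun ψ => valid_lift (x := fun _ => a) (valid_of_le h fun _ => le_rfl) ψ

/-- Over a one-point set, comparison with the constant `⊤` says `⊤ ⇾ a ∈ A.sep`, and modus ponens
applies. -/
theorem mem_sep_of_isTop {a : A} (h : IsTop (ArrowPred.const PUnit.{u + 1} a)) :
    a ∈ A.sep := by
  have h1 : Valid fun _ : PUnit.{u + 1} => (⊤ : A) ⇾ a := h (ArrowPred.const _ ⊤)
  exact A.isSeparator.modus_ponens (A.isSeparator.upward h1 (iInf_le _ PUnit.unit)) (top_mem A)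

/-! ### From implicative morphisms to cartesian transformations -/

/-- Post-composition with an implicative morphism is cartesian. -/
theorem isCartesian_postcomp (f : A ⟶ B) : IsCartesian (postcomp f) := by
  intro I
  refine ⟨fun t ht ψ => ?_, fun φ ψ m hm => ⟨?_, fun χ hχ => ?_⟩⟩
  -- The image of `⊤` need not be `⊤`, but it lies in the separator, and this suffices for its
  -- constant predicate to be top.
  · have h1 : ArrowPred.const I ⊤ ≤ t := ht _
    exact (isTop_of_mem_sep (f.map_sep _ (top_mem A)) ψ).trans ((postcomp f).mono I h1)
  · rintro _ (rfl | rfl)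
    exacts [(postcomp f).mono I (hm.1 (by simp)), (postcomp f).mono I (hm.1 (by simp))]
  · have h1 : χ ≤ (postcomp f).app I φ := hχ (by simp)
    have h2 : χ ≤ (postcomp f).app I ψ := hχ (by simp)
    -- Currying the meet turns it into an implication, which `f` respects laxly through its
    -- realizer.
    have h3 : φ ≤ ArrowPred.imp ψ m :=
      (ArrowPred.imp_gc φ ψ m).2 (hm.2 (ArrowPred.isGLB_inf φ ψ).1)
    have h4 : Valid fun i => χ i ⇾ ImplicativeMorphism.toFun f (ψ i) ⇾
        ImplicativeMorphism.toFun f (m i) :=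
      valid_trans (valid_trans h1 (ImplicativeMorphism.map_valid f h3))
        (ImplicativeMorphism.valid_realized f ψ m)
    exact valid_mp1 h4 h2

/-- At the generic predicate the order on transformations is literally the order on implicative
morphisms; conversely, one realizer bounds all `f a ⇾ f' a` and so serves every predicate. -/
theorem postcomp_le_postcomp_iff {f f' : A ⟶ B} : postcomp f ≤ postcomp f' ↔ f ≤ f' := by
  constructor
  · intro h
    exact ⟨_, h A fun a => a, fun a => iInf_le _ a⟩
  · rintro ⟨r, hr, h⟩ I φ
    exact valid_of_le hr fun i => h (φ i)

theorem postcomp_preIso_postcomp_iff {f f' : A ⟶ B} :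
    postcomp f ≃ₚ postcomp f' ↔ f ≃ₚ f' :=
  and_congr postcomp_le_postcomp_iff postcomp_le_postcomp_iff

/-! ### From cartesian transformations to implicative morphisms -/

/-- The value of a transformation of arrow triposes at the generic predicate. -/
def Transformation.generic (Φ : arrowTripos A ⟶ arrowTripos B) : A → B :=
  Transformation.app Φ A (fun a : A => a)

/-- This is naturality along `φ : I → A` itself, since reindexing the generic predicate along `φ`
returns `φ`. -/
theorem Transformation.app_preIso_generic (Φ : arrowTripos A ⟶ arrowTripos B) {I : Type u}
    (φ : ArrowPred A I) :
    Transformation.app Φ I φ ≃ₚ ArrowPred.postcomp (Transformation.generic Φ) φ :=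
  Transformation.natural Φ φ (fun a : A => a)

theorem Transformation.generic_mono (Φ : arrowTripos A ⟶ arrowTripos B) {I : Type u}
    {φ ψ : ArrowPred A I} (h : φ ≤ ψ) :
    ArrowPred.postcomp (Transformation.generic Φ) φ ≤
      ArrowPred.postcomp (Transformation.generic Φ) ψ :=
  (Transformation.app_preIso_generic Φ φ).2.trans
    ((Transformation.mono Φ I h).trans (Transformation.app_preIso_generic Φ ψ).1)

/-- The implicative morphism inducing a cartesian transformation of arrow triposes. -/
def implicativeOfCartesian (Φ : arrowTripos A ⟶ arrowTripos B) (hΦ : IsCartesian Φ) : A ⟶ B where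
  toFun := Transformation.generic Φ
  map_sep a ha := mem_sep_of_isTop fun ψ =>
    ((hΦ _).top _ (isTop_of_mem_sep ha) ψ).trans
      (Transformation.app_preIso_generic Φ (ArrowPred.const PUnit.{u + 1} a)).1
  realized := by
    -- The two projections form the universal pair of predicates, so one inequality over `A × A`
    -- yields a realizer uniform in `a` and `a'`. It is the transpose of the image under `Φ` of the
    -- evaluation `hev`.
    let φ : ArrowPred A (A × A) := Prod.fst
    let ψ : ArrowPred A (A × A) := Prod.snd
    have hm := (hΦ _).inf _ _ _ (ArrowPred.isGLB_inf (ArrowPred.imp φ ψ) φ)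
    have hev : ArrowPred.inf (ArrowPred.imp φ ψ) φ ≤ ψ := (ArrowPred.imp_gc _ _ _).1 le_rfl
    have h : ArrowPred.postcomp (Transformation.generic Φ) (ArrowPred.imp φ ψ) ≤
        ArrowPred.imp (ArrowPred.postcomp (Transformation.generic Φ) φ)
          (ArrowPred.postcomp (Transformation.generic Φ) ψ) := by
      refine (ArrowPred.imp_gc _ _ _).2 (le_trans (hm.2 ?_)
        ((Transformation.mono Φ _ hev).trans (Transformation.app_preIso_generic Φ ψ).1))
      rintro _ (rfl | rfl)
      · exact (ArrowPred.inf_le_left _ _).trans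
          (Transformation.app_preIso_generic Φ (ArrowPred.imp φ ψ)).2
      · exact (ArrowPred.inf_le_right _ _).trans (Transformation.app_preIso_generic Φ φ).2
    exact ⟨_, h, fun a a' => iInf_le _ (a, a')⟩
  map_iInf X h := by
    rw [iInf_subtype'] at h ⊢
    -- With `X` itself as index set, the hypothesis says that the first projection lies below the
    -- second.
    exact Transformation.generic_mono Φ (I := X) (φ := fun p => p.1.1) (ψ := fun p => p.1.2) h

theorem postcomp_implicativeOfCartesian (Φ : arrowTripos A ⟶ arrowTripos B)
    (hΦ : IsCartesian Φ) : postcomp (implicativeOfCartesian Φ hΦ) ≃ₚ Φ :=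
  ⟨fun _ φ => (Transformation.app_preIso_generic Φ φ).2,
    fun _ φ => (Transformation.app_preIso_generic Φ φ).1⟩

/-! ### Adjunctions and geometric morphisms -/

/-- Adjunctions of transformations, expressed componentwise. -/
theorem isAdjoint_iff_forall_gc {P Q : Tripos.{u}} {Φ : P ⟶ Q} {Ψ : Q ⟶ P} :
    IsAdjoint Φ Ψ ↔ ∀ X : Type u, GaloisConnection (Φ.app X) (Ψ.app X) := by
  constructor
  · rintro ⟨h, h'⟩ X φ ψ
    exact ⟨fun k => (h X φ).trans (Ψ.mono X k), fun k => (Φ.mono X k).trans (h' X ψ)⟩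
  · exact fun h => ⟨fun X => (h X).le_u_l, fun X => (h X).l_u_le⟩

theorem isAdjoint_congr {C : Type*} [Category C] [PreorderEnriched C] {X Y : C}
    {f f' : X ⟶ Y} {g g' : Y ⟶ X} (hf : f ≃ₚ f') (hg : g ≃ₚ g') (h : IsAdjoint f g) :
    IsAdjoint f' g' :=
  ⟨h.1.trans (PreorderEnriched.comp_mono hf.1 hg.1),
    (PreorderEnriched.comp_mono hg.2 hf.2).trans h.2⟩

/-- Post-composition commutes with identities and composites definitionally, so unit and counit
transfer along `postcomp_le_postcomp_iff`. -/
theorem isAdjoint_postcomp_iff {f : A ⟶ B} {h : B ⟶ A} :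
    IsAdjoint (postcomp f) (postcomp h) ↔ IsAdjoint f h :=
  and_congr (postcomp_le_postcomp_iff (f := 𝟙 A) (f' := f ≫ h))
    (postcomp_le_postcomp_iff (f := h ≫ f) (f' := 𝟙 B))

theorem isGeometricMorphism_postcomp {f : A ⟶ B} {h : B ⟶ A} (hfh : IsAdjoint f h) :
    IsGeometricMorphism (postcomp f) (postcomp h) :=
  ⟨isCartesian_postcomp f, isAdjoint_iff_forall_gc.1 (isAdjoint_postcomp_iff.2 hfh)⟩

/-- Geometric morphisms of arrow triposes are induced by adjunctions of arrow algebras. -/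
theorem IsGeometricMorphism.exists_isAdjoint {Φinv : arrowTripos A ⟶ arrowTripos B}
    {Φdir : arrowTripos B ⟶ arrowTripos A} (hΦ : IsGeometricMorphism Φinv Φdir) :
    ∃ (f : A ⟶ B) (h : B ⟶ A), IsAdjoint f h ∧ postcomp f ≃ₚ Φinv ∧ postcomp h ≃ₚ Φdir := by
  have hf := postcomp_implicativeOfCartesian Φinv hΦ.1
  -- Cartesianness of the direct image is not part of the data; it follows from its being a right
  -- adjoint.
  have hh := postcomp_implicativeOfCartesian Φdir fun X => preservesFiniteMeets_of_gc (hΦ.2 X)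
  exact ⟨_, _, isAdjoint_postcomp_iff.1
    (isAdjoint_congr hf.symm hh.symm (isAdjoint_iff_forall_gc.2 hΦ.2)), hf, hh⟩

/-! ### The 2-functor and the theorem -/

/-- The 2-functor from arrow algebras and computationally dense morphisms to triposes and
geometric morphisms. -/
def arrowTriposTwoFunctor : TwoFunctor ArrAlgCd.{u} TripGeom.{u} where
  obj X := ⟨arrowTripos X.obj⟩
  map f := ⟨postcomp f.hom, f.property.elim fun _ hh => ⟨_, isGeometricMorphism_postcomp hh⟩⟩
  map_mono h := postcomp_le_postcomp_iff.2 h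

theorem arrowTriposTwoFunctor_isTwoFullyFaithful :
    arrowTriposTwoFunctor.{u}.IsTwoFullyFaithful := by
  refine fun X Y => isPreorderEquivalence_of_le_iff (fun _ _ => postcomp_le_postcomp_iff) ?_
  rintro ⟨Φ, Φ', hΦ⟩
  obtain ⟨f, h, hfh, hf, -⟩ := hΦ.exists_isAdjoint
  -- The adjoint `h`, descended from the direct image, witnesses computational density of `f`.
  exact ⟨⟨f, h, hfh⟩, hf⟩

end ArrowTripos

theorem proposition6p9 :
    -- a computationally dense morphism induces a geometric morphism, with inverse image `f ∘ -`
    -- and direct image `h ∘ -`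
    (∀ (A B : ArrAlg.{u}) (f : A ⟶ B) (h : B ⟶ A), IsAdjoint f h →
      IsGeometricMorphism (postcomp f) (postcomp h)) ∧
    -- the 2-functor `A ↦ arrowTripos A`, `f ↦ postcomp f` restricts to a 2-fully faithful
    -- 2-functor from `ArrAlgCd` to `TripGeom`
    (∃ F : TwoFunctor ArrAlgCd.{u} TripGeom.{u},
      F.toFunctor ⋙ wideSubcategoryInclusion geometric =
        wideSubcategoryInclusion computationallyDense ⋙ arrowTriposFunctor ∧
      F.IsTwoFullyFaithful) ∧
    -- every geometric morphism of arrow triposes comes from an essentially unique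
    -- computationally dense morphism
    (∀ (A B : ArrAlg.{u}) (Φinv : arrowTripos A ⟶ arrowTripos B)
      (Φdir : arrowTripos B ⟶ arrowTripos A), IsGeometricMorphism Φinv Φdir →
      ∃ (f : A ⟶ B) (h : B ⟶ A), IsAdjoint f h ∧ postcomp f ≃ₚ Φinv ∧ postcomp h ≃ₚ Φdir ∧
        ∀ f' : A ⟶ B, computationallyDense f' → postcomp f' ≃ₚ Φinv → f' ≃ₚ f) := by
  refine ⟨fun _ _ _ _ => isGeometricMorphism_postcomp,
    ⟨arrowTriposTwoFunctor, rfl, arrowTriposTwoFunctor_isTwoFullyFaithful⟩,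
    fun A B Φinv Φdir hΦ => ?_⟩
  obtain ⟨f, h, hfh, hf, hh⟩ := hΦ.exists_isAdjoint
  -- Uniqueness holds because post-composition reflects isomorphism.
  exact ⟨f, h, hfh, hf, hh, fun f' _ hf' =>
    postcomp_preIso_postcomp_iff.1 (hf'.trans hf.symm)⟩
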